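/- Let $n,k\ge 1$ be integers with $k\mid n$, and let $2n$ points be distributed equidistantly on a circle and coloured red and blue so that, in circular order, they form $2n/k$ alternately coloured chunks, each consisting of exactly $k$ consecutive points of one colour (so there are $n$ red and $n$ blue points). A bichromatic travelling-salesman tour is a closed tour that visits every point exactly once and consists of segments each of which joins a red and a blue point; segments may cross (for $n=1$ the tour traverses the only segment twice). The length of a segment $uv$ is the minimum, over the two arcs of the circle between $u$ and $v$, of the number of input points on the arc, including $u$ and $v$; the length of a tour is the sum of the lengths of its segments. Then a bichromatic travelling-salesman tour of minimum length can be computed in linear time when the points are given in their circular order: there are a constant $C$ and a single program for a unit-cost random-access machine (copying constants, addition, truncated subtraction, comparison, indirect loads and stores) that, for all such $n$, $k$ and all such configurations, given the number $2n$ and the array of the colours of the points in clockwise or counterclockwise order starting from an arbitrary point, halts after at most $Cn$ steps, using machine words that hold only numbers up to $Cn$, and outputs the sequence of indices of the points in the order in which a minimum-length tour visits them. Moreover, the minimum length equals $$n\Bigl(k+2+\frac{2}{k}\Bigr)\ \text{ if } k \text{ is even},\qquad n\Bigl(k+2+\frac{1}{k}\Bigr)\ \text{ if } k \text{ is odd}.$$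 -/

import Mathlib

namespace ChunkedTour

/-! ## Geometry: equidistant points on a circle, arcs, and length in point counts -/

/-- The arc that is swept on the circle around `c` through `u` when one moves counterclockwise
from `u` until `v` is reached for the first time, both ends included (the plane is `ℂ`).
The same set is the clockwise arc from `v` to `u`. -/
def ccwArc (c u v : ℂ) : Set ℂ :=
  {z | ∃ s t : ℝ, 0 ≤ s ∧ s ≤ t ∧ t < 2 * Real.pi ∧
    v = c + Complex.exp (t * Complex.I) * (u - c) ∧
    z = c + Complex.exp (s * Complex.I) * (u - c)}

/-- `P 0, …, P (N - 1)` are equidistant points on a nondegenerate circle with centre `c`, listed in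
counterclockwise (`σ = 1`) or in clockwise (`σ = -1`) order. -/
def IsEquidistant {N : ℕ} (c : ℂ) (P : Fin N → ℂ) : Prop :=
  ∃ a : ℂ, a ≠ 0 ∧ ∃ σ : ℝ, (σ = 1 ∨ σ = -1) ∧
    ∀ i : Fin N, P i = c +
      Complex.exp (((σ * (2 * Real.pi * ((i : ℕ) : ℝ) / (N : ℝ)) : ℝ) : ℂ) * Complex.I) * a

/-- The number of input points on the counterclockwise arc from `u` to `v`, ends included. -/
noncomputable def arcCount {N : ℕ} (c : ℂ) (P : Fin N → ℂ) (u v : ℂ) : ℕ :=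
  {i : Fin N | P i ∈ ccwArc c u v}.ncard

/-- The length of the segment `uv` in point-count units: the smaller one of the numbers of input
points on the two arcs between `u` and `v`, with `u` and `v` included. -/
noncomputable def edgeLength {N : ℕ} (c : ℂ) (P : Fin N → ℂ) (u v : ℂ) : ℕ :=
  min (arcCount c P u v) (arcCount c P v u)

/-! ## Colours and tours -/

/-- The colouring (`true` is red, `false` is blue) of `2 * n` points in circular order consists of
alternately coloured chunks of exactly `k` consecutive points each. The number `s` says where in
a chunk the enumeration starts: point `i` belongs to chunk number `(i + s) / k`, and the even
chunks are the red ones. As `k` divides `n`, the pattern closes up around the circle. -/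
def IsChunked (n k : ℕ) (red : Fin (2 * n) → Bool) : Prop :=
  0 < k ∧ k ∣ n ∧ ∃ s : ℕ, ∀ i : Fin (2 * n), red i = decide (((i : ℕ) + s) / k % 2 = 0)

/-- A bichromatic travelling-salesman tour, given by the order in which all the points are visited:
`τ j` is the index of the point visited at time `j`, and any two cyclically consecutive points
have different colours (`finRotate N` is the cyclic successor on `Fin N`). -/
def IsTour {N : ℕ} (red : Fin N → Bool) (τ : Equiv.Perm (Fin N)) : Prop :=
  ∀ j : Fin N, red (τ j) ≠ red (τ (finRotate N j))

/-- The total length of the closed tour `τ`. -/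
noncomputable def tourLength {N : ℕ} (c : ℂ) (P : Fin N → ℂ) (τ : Equiv.Perm (Fin N)) : ℕ :=
  ∑ j : Fin N, edgeLength c P (P (τ j)) (P (τ (finRotate N j)))

/-- `τ` is a bichromatic tour of minimum length. -/
def IsOptimalTour {N : ℕ} (c : ℂ) (P : Fin N → ℂ) (red : Fin N → Bool)
    (τ : Equiv.Perm (Fin N)) : Prop :=
  IsTour red τ ∧ ∀ τ' : Equiv.Perm (Fin N), IsTour red τ' → tourLength c P τ ≤ tourLength c P τ'

/-! ## The model of computation: a word RAM with unit-cost instructions -/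

/-- Programs. Register and memory cells hold natural numbers; registers are named by numbers, so a
program uses a fixed finite number of them, while memory is addressed indirectly. -/
inductive Prog : Type
  /-- `reg x := a` -/
  | const (x a : ℕ)
  /-- `reg x := reg y + reg z` -/
  | add (x y z : ℕ)
  /-- `reg x := reg y - reg z` (zero if the difference is negative) -/
  | sub (x y z : ℕ)
  /-- `reg x := mem[reg y]` -/
  | load (x y : ℕ)
  /-- `mem[reg x] := reg y` -/
  | store (x y : ℕ)
  /-- do nothing -/
  | skip
  /-- first `p`, then `q` -/
  | seq (p q : Prog)
  /-- if `reg x < reg y` then `p` else `q` -/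
  | ite (x y : ℕ) (p q : Prog)
  /-- while `reg x < reg y` do `p` -/
  | loop (x y : ℕ) (p : Prog)

/-- The contents of the registers and of the memory. -/
structure State : Type where
  reg : ℕ → ℕ
  mem : ℕ → ℕ

/-- `Exec W p S t S'`: started in the state `S`, the program `p` halts in the state `S'` after
exactly `t` steps, where each instruction and each evaluation of a test counts as one step.
Machine words can hold the numbers `0, …, W`: an instruction that would produce a larger number
has no execution. -/
inductive Exec (W : ℕ) : Prog → State → ℕ → State → Prop
  | const (x a : ℕ) (S : State) (hW : a ≤ W) :
      Exec W (Prog.const x a) S 1 ⟨Function.update S.reg x a, S.mem⟩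
  | add (x y z : ℕ) (S : State) (hW : S.reg y + S.reg z ≤ W) :
      Exec W (Prog.add x y z) S 1 ⟨Function.update S.reg x (S.reg y + S.reg z), S.mem⟩
  | sub (x y z : ℕ) (S : State) (hW : S.reg y - S.reg z ≤ W) :
      Exec W (Prog.sub x y z) S 1 ⟨Function.update S.reg x (S.reg y - S.reg z), S.mem⟩
  | load (x y : ℕ) (S : State) :
      Exec W (Prog.load x y) S 1 ⟨Function.update S.reg x (S.mem (S.reg y)), S.mem⟩
  | store (x y : ℕ) (S : State) :
      Exec W (Prog.store x y) S 1 ⟨S.reg, Function.update S.mem (S.reg x) (S.reg y)⟩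
  | skip (S : State) : Exec W Prog.skip S 1 S
  | seq (p q : Prog) (S S' S'' : State) (t t' : ℕ)
      (hp : Exec W p S t S') (hq : Exec W q S' t' S'') :
      Exec W (Prog.seq p q) S (t + t') S''
  | ite_true (x y : ℕ) (p q : Prog) (S S' : State) (t : ℕ)
      (hlt : S.reg x < S.reg y) (hp : Exec W p S t S') :
      Exec W (Prog.ite x y p q) S (t + 1) S'
  | ite_false (x y : ℕ) (p q : Prog) (S S' : State) (t : ℕ)
      (hlt : ¬ S.reg x < S.reg y) (hq : Exec W q S t S') :
      Exec W (Prog.ite x y p q) S (t + 1) S'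
  | loop_true (x y : ℕ) (p : Prog) (S S' S'' : State) (t t' : ℕ)
      (hlt : S.reg x < S.reg y) (hp : Exec W p S t S')
      (hl : Exec W (Prog.loop x y p) S' t' S'') :
      Exec W (Prog.loop x y p) S (t + t' + 1) S''
  | loop_false (x y : ℕ) (p : Prog) (S : State) (hlt : ¬ S.reg x < S.reg y) :
      Exec W (Prog.loop x y p) S 1 S

/-- The initial state: register `0` holds the number `N` of points, the memory cells
`0, …, N - 1` hold the colours of the points in their circular order (`1` for red, `0` for blue),
and everything else is `0`. -/
def inputState {N : ℕ} (red : Fin N → Bool) : State where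
  reg x := if x = 0 then N else 0
  mem a := if h : a < N then (if red ⟨a, h⟩ then 1 else 0) else 0

/-- The output convention: the memory cells `N, …, 2 * N - 1` list the indices of the points in
the order in which the tour `τ` visits them. -/
def Outputs {N : ℕ} (S : State) (τ : Equiv.Perm (Fin N)) : Prop :=
  ∀ j : Fin N, S.mem (N + (j : ℕ)) = ((τ j : Fin N) : ℕ)

end ChunkedTour

namespace ChunkedTour

/-! An edge has length one more than the circular distance of its ends (`edgeLength_eq`), so a tour
on `2n` points costs `2n` plus its total distance. Write `n = m * k`.

Lower bound: a bichromatic edge crosses a chunk boundary, so its distance is at least the sum of the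
distances from its ends to their nearest boundaries. Each point lies on two edges, and summing these
distances gives `m * (k * k + k % 2)`, which settles odd `k`. For even `k` every point has a unique
nearest boundary, and an edge whose ends have different nearest boundaries is longer than this
estimate by at least 1. The tour serves all `2 * m` boundaries, so it has at least `2 * m` such
edges, whence the extra `2 * m` (`chunkWeight_add_le`, `card_le_card_changes`, `le_tourLength`).

Upper bound: visit both colours alternately, each in circular order, one shifted by half a chunk
against the other. The step distances repeat with period `2 * k` and sum exactly to the bound
(`sum_visit_dist`).

Algorithm: two scans find a chunk boundary and `k`, a loop halves `k`, and two pointers advancing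
through the two colours write this tour, with constant work per point (`runs_tourProg`). -/

/-! ### Edge lengths as circular distances. -/

theorem exp_eq_exp_iff_eq_emod {N : ℕ} (hN : 0 < N) (e : ℤ) {s : ℝ} (hs : 0 ≤ s)
    (hs' : s < 2 * Real.pi) :
    Complex.exp (s * Complex.I) =
        Complex.exp (((2 * Real.pi * (e : ℝ) / (N : ℝ) : ℝ) : ℂ) * Complex.I) ↔
      s = 2 * Real.pi * ((e % (N : ℤ) : ℤ) : ℝ) / N := by
  have hpi := Real.pi_pos
  have hNR : (0 : ℝ) < N := by exact_mod_cast hN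
  rw [Complex.exp_eq_exp_iff_exists_int]
  have key : ∀ z : ℤ, ((s : ℂ) * Complex.I =
      ((2 * Real.pi * (e : ℝ) / (N : ℝ) : ℝ) : ℂ) * Complex.I + z * (2 * Real.pi * Complex.I)) ↔
      s = 2 * Real.pi * ((e + z * N : ℤ) : ℝ) / N := by
    intro z
    have : ((2 * Real.pi * (e : ℝ) / (N : ℝ) : ℝ) : ℂ) * Complex.I +
        z * (2 * Real.pi * Complex.I) =
        ((2 * Real.pi * ((e + z * N : ℤ) : ℝ) / N : ℝ) : ℂ) * Complex.I := by
      have : (N : ℂ) ≠ 0 := by exact_mod_cast hN.ne'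
      push_cast
      field_simp
    rw [this, mul_left_inj' Complex.I_ne_zero]
    exact Complex.ofReal_inj
  constructor
  · rintro ⟨z, hz⟩
    rw [key] at hz
    have h0 : (0 : ℝ) ≤ ((e + z * N : ℤ) : ℝ) := by
      by_contra h
      push Not at h
      have : s < 0 := by
        rw [hz]
        exact div_neg_of_neg_of_pos (mul_neg_of_pos_of_neg (by positivity) h) hNR
      linarith
    have h1 : ((e + z * N : ℤ) : ℝ) < ((N : ℤ) : ℝ) := by
      rw [hz, div_lt_iff₀ hNR] at hs'
      push_cast at hs' ⊢
      exact lt_of_mul_lt_mul_left hs' (by positivity)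
    have h2 : e % (N : ℤ) = e + z * N := by
      rw [← Int.add_mul_emod_self_right e z N]
      exact Int.emod_eq_of_lt (by exact_mod_cast h0) (by exact_mod_cast h1)
    rw [h2, ← hz]
  · intro h
    refine ⟨-(e / N), (key _).2 ?_⟩
    rw [h]
    congr 3
    have := Int.emod_add_mul_ediv e N
    linarith

/-- Angles in `[0, 2π)` are unique, so the parameters `s`, `t` of the arc must be the residues of `x
- i` and `j - i`, scaled by `2π / N`. Integer indices allow negative ones, which describe clockwise
labelling. -/
theorem mem_ccwArc_iff {N : ℕ} (hN : 0 < N) {c a : ℂ} (ha : a ≠ 0) (i j x : ℤ) :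
    (c + Complex.exp (((2 * Real.pi * (x : ℝ) / N : ℝ) : ℂ) * Complex.I) * a ∈
      ccwArc c (c + Complex.exp (((2 * Real.pi * (i : ℝ) / N : ℝ) : ℂ) * Complex.I) * a)
        (c + Complex.exp (((2 * Real.pi * (j : ℝ) / N : ℝ) : ℂ) * Complex.I) * a)) ↔
      (x - i) % (N : ℤ) ≤ (j - i) % (N : ℤ) := by
  have hpi := Real.pi_pos
  have hNR : (0 : ℝ) < N := by exact_mod_cast hN
  have hNZ : (0 : ℤ) < N := by exact_mod_cast hN
  have key : ∀ (y : ℤ) (s : ℝ), 0 ≤ s → s < 2 * Real.pi →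
      (c + Complex.exp (((2 * Real.pi * (y : ℝ) / N : ℝ) : ℂ) * Complex.I) * a =
        c + Complex.exp (s * Complex.I) *
          (c + Complex.exp (((2 * Real.pi * (i : ℝ) / N : ℝ) : ℂ) * Complex.I) * a - c) ↔
      s = 2 * Real.pi * (((y - i) % (N : ℤ) : ℤ) : ℝ) / N) := by
    intro y s h0 h1
    rw [← exp_eq_exp_iff_eq_emod hN _ h0 h1, add_right_inj, add_sub_cancel_left, ← mul_assoc,
      mul_left_inj' ha]
    have : Complex.exp (((2 * Real.pi * (y : ℝ) / N : ℝ) : ℂ) * Complex.I) =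
        Complex.exp (((2 * Real.pi * ((y - i : ℤ) : ℝ) / N : ℝ) : ℂ) * Complex.I) *
        Complex.exp (((2 * Real.pi * (i : ℝ) / N : ℝ) : ℂ) * Complex.I) := by
      rw [← Complex.exp_add, ← add_mul]
      congr 2
      push_cast
      ring
    rw [this, mul_left_inj' (Complex.exp_ne_zero _)]
    exact eq_comm
  have bound : ∀ y : ℤ, 0 ≤ 2 * Real.pi * ((y % (N : ℤ) : ℤ) : ℝ) / N ∧
      2 * Real.pi * ((y % (N : ℤ) : ℤ) : ℝ) / N < 2 * Real.pi := by
    intro y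
    have h0 : (0 : ℝ) ≤ ((y % (N : ℤ) : ℤ) : ℝ) := by
      exact_mod_cast Int.emod_nonneg y hNZ.ne'
    have h1 : ((y % (N : ℤ) : ℤ) : ℝ) < ((N : ℤ) : ℝ) := by
      exact_mod_cast Int.emod_lt_of_pos y hNZ
    refine ⟨by positivity, ?_⟩
    rw [div_lt_iff₀ hNR]
    exact mul_lt_mul_of_pos_left (by simpa using h1) (by positivity)
  have mono : ∀ y z : ℤ, 2 * Real.pi * (y : ℝ) / N ≤ 2 * Real.pi * (z : ℝ) / N ↔ y ≤ z := by
    intro y z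
    rw [div_le_div_iff_of_pos_right hNR, mul_le_mul_iff_right₀ (by positivity)]
    exact Int.cast_le
  constructor
  · rintro ⟨s, t, h0, hst, ht, hv, hz⟩
    rw [key _ _ (h0.trans hst) ht] at hv
    rw [key _ _ h0 (hst.trans_lt ht)] at hz
    rw [hv, hz, mono] at hst
    exact hst
  · intro h
    exact ⟨_, _, (bound _).1, (mono _ _).2 h, (bound _).2,
      (key _ _ (bound _).1 (bound _).2).2 rfl, (key _ _ (bound _).1 (bound _).2).2 rfl⟩

theorem val_sub_eq_emod {N : ℕ} (i j : Fin N) :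
    (((j - i : Fin N) : ℕ) : ℤ) = ((j : ℤ) - (i : ℤ)) % (N : ℤ) := by
  rw [Fin.sub_def]
  have := i.2
  push_cast [Nat.cast_sub i.2.le]
  rw [show (N : ℤ) - i + j = j - i + N by ring, Int.add_emod_right]

/-- The alternatives are the two orientations of the labelling. They only exchange the two arcs, so
the minimum in `edgeLength` does not see the difference. -/
theorem arcCount_eq_ncard {N : ℕ} {c : ℂ} {P : Fin N → ℂ} (h : IsEquidistant c P) :
    (∀ i j, arcCount c P (P i) (P j) = {x : Fin N | x - i ≤ j - i}.ncard) ∨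
    (∀ i j, arcCount c P (P i) (P j) = {x : Fin N | i - x ≤ i - j}.ncard) := by
  obtain ⟨a, ha, σ, rfl | rfl, hP⟩ := h
  · left
    intro i j
    unfold arcCount
    congr 1
    ext x
    have hN : 0 < N := i.pos
    have e : ∀ y : Fin N, P y =
        c + Complex.exp (((2 * Real.pi * (((y : ℕ) : ℤ) : ℝ) / N : ℝ) : ℂ) * Complex.I) * a := by
      intro y; rw [hP]; simp
    rw [Set.mem_ofPred_eq, Set.mem_ofPred_eq, e, e, e, mem_ccwArc_iff hN ha, Fin.le_def,
      ← val_sub_eq_emod, ← val_sub_eq_emod]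
    norm_cast
  · right
    intro i j
    unfold arcCount
    congr 1
    ext x
    have hN : 0 < N := i.pos
    have e : ∀ y : Fin N, P y =
        c + Complex.exp (((2 * Real.pi * ((-((y : ℕ) : ℤ) : ℤ) : ℝ) / N : ℝ) : ℂ) *
          Complex.I) * a := by
      intro y; rw [hP]; congr 4; push_cast; ring
    rw [Set.mem_ofPred_eq, Set.mem_ofPred_eq, e, e, e, mem_ccwArc_iff hN ha, Fin.le_def]
    rw [show -((x : ℕ) : ℤ) - -((i : ℕ) : ℤ) = (i : ℕ) - (x : ℕ) by ring,
      show -((j : ℕ) : ℤ) - -((i : ℕ) : ℤ) = (i : ℕ) - (j : ℕ) by ring,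
      ← val_sub_eq_emod, ← val_sub_eq_emod]
    norm_cast

/-- The edge length between two input points is one more than their circular distance. -/
theorem edgeLength_eq {N : ℕ} {c : ℂ} {P : Fin N → ℂ} (h : IsEquidistant c P) (i j : Fin N) :
    edgeLength c P (P i) (P j) = min ((j - i : Fin N) : ℕ) ((i - j : Fin N) : ℕ) + 1 := by
  have : NeZero N := ⟨i.pos.ne'⟩
  have card : ∀ d : Fin N, (Set.Iic d).ncard = (d : ℕ) + 1 := by
    intro d
    rw [← Finset.coe_Iic, Set.ncard_coe_finset, Fin.card_Iic]
  have h1 : ∀ i d : Fin N, {x : Fin N | x - i ≤ d}.ncard = (d : ℕ) + 1 := by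
    intro i d
    rw [← card d]
    exact Set.ncard_congr (fun x _ => x - i) (fun x hx => hx)
      (fun x y _ _ hxy => sub_left_injective hxy)
      (fun y hy => ⟨y + i, by simpa using hy, by simp⟩)
  have h2 : ∀ i d : Fin N, {x : Fin N | i - x ≤ d}.ncard = (d : ℕ) + 1 := by
    intro i d
    rw [← card d]
    exact Set.ncard_congr (fun x _ => i - x) (fun x hx => hx)
      (fun x y _ _ hxy => sub_right_injective hxy)
      (fun y hy => ⟨i - y, by simpa using hy, by simp⟩)
  unfold edgeLength
  rcases arcCount_eq_ncard h with h | h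
  · rw [h, h, h1, h1]; omega
  · rw [h, h, h2, h2]; omega

/-! ### The lower bound. -/

theorem val_finRotate {N : ℕ} (j : Fin N) : ((finRotate N j : Fin N) : ℕ) = ((j : ℕ) + 1) % N := by
  have : NeZero N := ⟨j.pos.ne'⟩
  rw [finRotate_apply, Fin.val_add, Fin.val_one', Nat.add_mod_mod]

/-- A cyclic sequence that takes at least two values changes its value at least as often as it has
values. -/
theorem card_le_card_changes {N M : ℕ} (hM : 2 ≤ M) (g : Fin N → ℕ)
    (hg : ∀ v < M, ∃ j, g j = v) :
    M ≤ (Finset.univ.filter fun j : Fin N => g j ≠ g (finRotate N j)).card := by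
  suffices h : Finset.range M ⊆
      (Finset.univ.filter fun j : Fin N => g j ≠ g (finRotate N j)).image g by
    calc M = (Finset.range M).card := (Finset.card_range M).symm
      _ ≤ _ := Finset.card_le_card h
      _ ≤ _ := Finset.card_image_le
  intro v hv
  rw [Finset.mem_range] at hv
  by_contra hcon
  -- Every value has to be left at some time. Otherwise, once taken, it persists around the whole
  -- cycle and no other value occurs.
  have stay : ∀ j, g j = v → g (finRotate N j) = v := by
    intro j hj
    by_contra hne
    refine hcon (Finset.mem_image.2 ⟨j, ?_, hj⟩)
    simp only [Finset.mem_filter, Finset.mem_univ, true_and]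
    rw [hj]
    exact Ne.symm hne
  obtain ⟨j₀, hj₀⟩ := hg v hv
  have hN := j₀.pos
  have all : ∀ t : ℕ, g ⟨(j₀ + t) % N, Nat.mod_lt _ hN⟩ = v := by
    intro t
    induction t with
    | zero => simpa [Nat.mod_eq_of_lt j₀.2] using hj₀
    | succ t ih =>
      have := stay _ ih
      convert this using 2
      apply Fin.ext
      rw [val_finRotate]
      simp [Nat.add_assoc]
  obtain ⟨w, hw, hwv⟩ : ∃ w < M, w ≠ v := by
    rcases Nat.eq_zero_or_pos v with h | h
    · exact ⟨1, by omega, by omega⟩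
    · exact ⟨0, by omega, by omega⟩
  obtain ⟨j₁, hj₁⟩ := hg w hw
  apply hwv
  rw [← hj₁, ← all (N - j₀ + j₁)]
  congr 1
  apply Fin.ext
  have := j₀.2
  change (j₁ : ℕ) = (j₀ + (N - j₀ + j₁)) % N
  rw [show (j₀ : ℕ) + (N - j₀ + j₁) = j₁ + N by omega, Nat.add_mod_right,
    Nat.mod_eq_of_lt j₁.2]

/-- Twice the distance from position `p` in a chunk of `k` points to the nearest end of the
chunk, the ends being half-way between points. -/
def chunkWeight (k p : ℕ) : ℕ := min (2 * p + 1) (2 * k - (2 * p + 1))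

/-- Passing from `k` to `k + 2` adds an end point of weight 1 on either side and raises every inner
weight by 2. -/
theorem two_mul_sum_chunkWeight (k : ℕ) :
    2 * ∑ p ∈ Finset.range k, chunkWeight k p = k * k + k % 2 := by
  induction k using Nat.twoStepInduction with
  | zero => simp
  | one => simp [chunkWeight]
  | more k ih _ =>
    rw [Finset.sum_range_succ, Finset.sum_range_succ']
    have h : ∀ p ∈ Finset.range k, chunkWeight (k + 2) (p + 1) = chunkWeight k p + 2 := by
      intro p hp
      rw [Finset.mem_range] at hp
      unfold chunkWeight
      omega
    have h0 : chunkWeight (k + 2) 0 = 1 := by unfold chunkWeight; omega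
    have h1 : chunkWeight (k + 2) (k + 1) = 1 := by unfold chunkWeight; omega
    rw [Finset.sum_congr rfl h, Finset.sum_add_distrib, h0, h1, Nat.add_mod_right]
    simp only [Finset.sum_const, Finset.card_range, smul_eq_mul]
    linarith

theorem sum_range_mul_of_periodic {k : ℕ} {f : ℕ → ℕ} (hf : ∀ x, f (x + k) = f x) (a s : ℕ) :
    ∑ i ∈ Finset.range (a * k), f (i + s) = a * ∑ p ∈ Finset.range k, f p := by
  have shift : ∀ s, ∑ p ∈ Finset.range k, f (p + s) = ∑ p ∈ Finset.range k, f p := by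
    intro s
    induction s with
    | zero => rfl
    | succ s ih =>
      rw [← ih]
      have h1 := Finset.sum_range_succ (fun p => f (p + s)) k
      have h2 := Finset.sum_range_succ' (fun p => f (p + s)) k
      have h3 : f (k + s) = f (0 + s) := by rw [Nat.add_comm, hf, Nat.zero_add]
      simp only [Nat.add_right_comm _ 1 s] at h2
      simp only [← Nat.add_assoc]
      omega
  induction a with
  | zero => simp
  | succ a ih =>
    rw [Nat.succ_mul, Finset.sum_range_add, ih, Nat.succ_mul]
    congr 1
    rw [← shift (a * k + s)]
    exact Finset.sum_congr rfl fun p _ => by congr 1; ring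

/-- The quotient `(x + k / 2) / k` is, for even `k`, the index of the boundary nearest to `x`.
Between adjacent chunks, `2 * (y - x)` is the sum of the doubled distances to the common boundary.
If that boundary is not nearest to one end, parity makes its contribution exceed the weight by at
least 2. If the chunks are further apart, there is ample slack, as weights are at most `k`. -/
theorem chunkWeight_add_le {k x y : ℕ} (hk : 0 < k) (hxy : x < y)
    (h : x / k % 2 ≠ y / k % 2) :
    chunkWeight k (x % k) + chunkWeight k (y % k) +
      (if Even k ∧ (x + k / 2) / k ≠ (y + k / 2) / k then 2 else 0) ≤ 2 * (y - x) := by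
  have hx := Nat.div_add_mod x k
  have hy := Nat.div_add_mod y k
  have hp := Nat.mod_lt x hk
  have hr := Nat.mod_lt y hk
  have hle : x / k ≤ y / k := Nat.div_le_div_right hxy.le
  -- Different colours mean chunk indices of different parity.
  obtain ⟨e, he⟩ : ∃ e, y / k = x / k + (2 * e + 1) := ⟨(y / k - x / k) / 2, by omega⟩
  have hq : ∀ z, (z + k / 2) / k = z / k + if z % k + k / 2 < k then 0 else 1 := by
    intro z
    have hz := Nat.div_add_mod z k
    have hz' := Nat.mod_lt z hk
    rw [Nat.mul_comm] at hz
    split_ifs with hc <;> apply Nat.div_eq_of_lt_le <;>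
      simp only [Nat.add_mul, Nat.one_mul, Nat.zero_mul] <;> omega
  have hd : y = x + k * (2 * e + 1) + y % k - x % k := by
    rw [he] at hy
    have : k * (x / k + (2 * e + 1)) = k * (x / k) + k * (2 * e + 1) := by ring
    omega
  rw [hq, hq, he]
  unfold chunkWeight
  rcases Nat.eq_zero_or_pos e with rfl | hepos
  · simp only [Nat.even_iff]
    split_ifs <;> omega
  · have : 3 * k ≤ k * (2 * e + 1) := by nlinarith
    split_ifs <;> omega

theorem chunkWeight_add_le_two_mul_min {m k s : ℕ} (hk : 0 < k) (i j : Fin (2 * (m * k)))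
    (h : (i + s) / k % 2 ≠ (j + s) / k % 2) :
    chunkWeight k ((i + s) % k) + chunkWeight k ((j + s) % k) +
      (if Even k ∧ (i + s + k / 2) / k % (2 * m) ≠ (j + s + k / 2) / k % (2 * m) then 2 else 0) ≤
    2 * min ((j - i : Fin (2 * (m * k))) : ℕ) ((i - j : Fin (2 * (m * k))) : ℕ) := by
  wlog hij : (i : ℕ) ≤ j generalizing i j
  · have := this j i h.symm (by omega)
    rw [min_comm, Nat.add_comm (chunkWeight k ((i + s) % k))]
    simpa only [ne_comm] using this
  have hlt : (i : ℕ) < j := lt_of_le_of_ne hij (by intro e; rw [e] at h; exact h rfl)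
  have hj := j.2
  have e1 : ((j - i : Fin (2 * (m * k))) : ℕ) = j - i := by
    rw [Fin.sub_def]
    change (2 * (m * k) - i + j) % (2 * (m * k)) = _
    rw [show 2 * (m * k) - i + j = (j - i) + 2 * (m * k) by omega, Nat.add_mod_right,
      Nat.mod_eq_of_lt (by omega)]
  have e2 : ((i - j : Fin (2 * (m * k))) : ℕ) = 2 * (m * k) + i - j := by
    rw [Fin.sub_def]
    change (2 * (m * k) - j + i) % (2 * (m * k)) = _
    rw [Nat.mod_eq_of_lt (by omega)]
    omega
  have hper : ∀ z, (z + 2 * (m * k)) / k = z / k + 2 * m := by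
    intro z
    rw [← Nat.mul_assoc, Nat.add_mul_div_right _ _ hk]
  have hper' : ∀ z, (z + 2 * (m * k)) % k = z % k := by
    intro z
    rw [← Nat.mul_assoc, Nat.add_mul_mod_self_right]
  have a1 := chunkWeight_add_le hk (x := i + s) (y := j + s) (by omega) h
  -- The other arc runs from `j` to the copy of `i` one full turn later.
  have a2 := chunkWeight_add_le hk (x := j + s) (y := i + s + 2 * (m * k)) (by omega)
    (by rw [hper]; omega)
  rw [Nat.add_right_comm (i + s) _ (k / 2), hper, hper'] at a2
  rw [e1, e2]
  have g1 : (i + s + k / 2) / k % (2 * m) ≠ (j + s + k / 2) / k % (2 * m) →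
      (i + s + k / 2) / k ≠ (j + s + k / 2) / k := by
    intro hne he; rw [he] at hne; exact hne rfl
  have g2 : (i + s + k / 2) / k % (2 * m) ≠ (j + s + k / 2) / k % (2 * m) →
      (j + s + k / 2) / k ≠ (i + s + k / 2) / k + 2 * m := by
    intro hne he; rw [he, Nat.add_mod_right] at hne; exact hne rfl
  by_cases hev : Even k ∧ (i + s + k / 2) / k % (2 * m) ≠ (j + s + k / 2) / k % (2 * m)
  · rw [if_pos ⟨hev.1, g1 hev.2⟩] at a1
    rw [if_pos ⟨hev.1, g2 hev.2⟩] at a2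
    rw [if_pos hev]
    omega
  · rw [if_neg hev]
    omega

/-- The lower bound: no bichromatic tour is shorter than claimed. -/
theorem le_tourLength {m k : ℕ} (hm : 0 < m) (hk : 0 < k) {c : ℂ} {P : Fin (2 * (m * k)) → ℂ}
    (hP : IsEquidistant c P) {red : Fin (2 * (m * k)) → Bool} {s : ℕ}
    (hred : ∀ i : Fin (2 * (m * k)), red i = decide (((i : ℕ) + s) / k % 2 = 0))
    {τ : Equiv.Perm (Fin (2 * (m * k)))} (hτ : IsTour red τ) :
    m * (k * k + if Even k then 2 else 1) + 2 * (m * k) ≤ tourLength c P τ := by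
  set w : Fin (2 * (m * k)) → ℕ := fun i => chunkWeight k ((i + s) % k) with hw
  set g : Fin (2 * (m * k)) → ℕ := fun i => (i + s + k / 2) / k % (2 * m) with hg
  have hedge : ∀ j, w (τ j) + w (τ (finRotate _ j)) +
      ((if Even k ∧ g (τ j) ≠ g (τ (finRotate _ j)) then 2 else 0) + 2) ≤
      2 * edgeLength c P (P (τ j)) (P (τ (finRotate _ j))) := by
    intro j
    rw [edgeLength_eq hP]
    have hne := hτ j
    rw [hred, hred] at hne
    have := chunkWeight_add_le_two_mul_min (m := m) (s := s) hk (τ j) (τ (finRotate _ j)) (by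
      intro e; apply hne; rw [e])
    change w (τ j) + w (τ (finRotate _ j)) +
      (if Even k ∧ g (τ j) ≠ g (τ (finRotate _ j)) then 2 else 0) ≤ _ at this
    omega
  have hsum := Finset.sum_le_sum fun j (_ : j ∈ Finset.univ) => hedge j
  rw [Finset.sum_add_distrib, Finset.sum_add_distrib, Finset.sum_add_distrib, ← Finset.mul_sum,
    Equiv.sum_comp τ w, Equiv.sum_comp (finRotate _) (fun j => w (τ j)), Equiv.sum_comp τ w] at hsum
  have hW : 2 * ∑ i, w i = 2 * m * (k * k + k % 2) := by
    rw [hw, Fin.sum_univ_eq_sum_range (fun i => chunkWeight k ((i + s) % k)), ← Nat.mul_assoc,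
      sum_range_mul_of_periodic (f := fun x => chunkWeight k (x % k)) (by simp),
      ← two_mul_sum_chunkWeight, Finset.sum_congr rfl
        fun p hp => by rw [Nat.mod_eq_of_lt (Finset.mem_range.1 hp)]]
    ring
  have hC : (if Even k then 4 * m else 0) ≤
      ∑ j, if Even k ∧ g (τ j) ≠ g (τ (finRotate _ j)) then 2 else 0 := by
    split_ifs with hev
    · simp only [hev, true_and]
      rw [← Finset.sum_filter, Finset.sum_const, smul_eq_mul]
      have := card_le_card_changes (M := 2 * m) (by omega) (fun j => g (τ j)) (by
        intro v hv
        have hpos : 0 < 2 * (m * k) := by positivity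
        -- The factor `2 * (m * k) - 1` acts as `-1` modulo the number of points, so this is the
        -- point `v * k - (s + k / 2)`.
        refine ⟨τ.symm ⟨(v * k + (2 * (m * k) - 1) * (s + k / 2)) % (2 * (m * k)),
          Nat.mod_lt _ hpos⟩, ?_⟩
        rw [Equiv.apply_symm_apply]
        simp only [hg]
        rw [← Nat.mod_mul_right_div_self, show k * (2 * m) = 2 * (m * k) by ring, Nat.add_assoc,
          Nat.mod_add_mod]
        have : v * k + (2 * (m * k) - 1) * (s + k / 2) + (s + k / 2) =
            v * k + 2 * (m * k) * (s + k / 2) := by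
          obtain ⟨d, hd⟩ := Nat.exists_eq_succ_of_ne_zero hpos.ne'
          rw [hd]
          simp only [Nat.succ_eq_add_one, Nat.add_sub_cancel]
          ring
        rw [this, Nat.add_mul_mod_self_left, Nat.mod_eq_of_lt (by nlinarith),
          Nat.mul_div_cancel _ hk])
      omega
    · exact Nat.zero_le _
  simp only [Finset.sum_const, Finset.card_univ, Fintype.card_fin, smul_eq_mul] at hsum
  unfold tourLength
  have hmk : 2 * m * (k * k + k % 2) = 2 * (m * (k * k)) + 2 * (m * (k % 2)) := by ring
  rw [hmk] at hW
  split_ifs at hC ⊢ with hev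
  · rw [Nat.mul_add]
    omega
  · rw [Nat.not_even_iff] at hev
    rw [hev] at hW
    rw [Nat.mul_add]
    omega

/-! ### The optimal tour and its length. -/

/-- The position of the `u`-th point among the points of the even chunks of size `k`. -/
def spread (k u : ℕ) : ℕ := u + k * (u / k)

/-- The position, relative to a chunk boundary, of the point visited at time `j` by the optimal
tour: both colours are visited in circular order, the colour of chunk `0` starting in the middle of
chunk `0` and the other colour starting at the beginning of chunk `1`. -/
def visit (k j : ℕ) : ℕ := if j % 2 = 0 then spread k (j / 2 + k / 2) else k + spread k (j / 2)

theorem spread_strictMono (k : ℕ) : StrictMono (spread k) := fun _ _ h =>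
  Nat.add_lt_add_of_lt_of_le h (Nat.mul_le_mul_left _ (Nat.div_le_div_right h.le))

theorem spread_add_mul {k : ℕ} (hk : 0 < k) (u m : ℕ) :
    spread k (u + m * k) = spread k u + 2 * (m * k) := by
  unfold spread
  rw [Nat.add_mul_div_right _ _ hk]
  ring

theorem visit_add_mul {k : ℕ} (hk : 0 < k) (j m : ℕ) :
    visit k (j + 2 * (m * k)) = visit k j + 2 * (m * k) := by
  unfold visit
  rw [Nat.add_mul_mod_self_left, Nat.add_mul_div_left _ _ (by norm_num),
    Nat.add_right_comm, spread_add_mul hk, spread_add_mul hk]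
  split_ifs <;> omega

theorem spread_div {k : ℕ} (hk : 0 < k) (u : ℕ) : spread k u / k = 2 * (u / k) := by
  unfold spread
  rw [Nat.add_mul_div_left _ _ hk]
  omega

theorem visit_div_mod_two {k : ℕ} (hk : 0 < k) (j : ℕ) : visit k j / k % 2 = j % 2 := by
  unfold visit
  split_ifs with h
  · rw [spread_div hk]
    omega
  · rw [Nat.add_div_left _ hk, spread_div hk]
    omega

theorem visit_injOn_mod {m k : ℕ} (hk : 0 < k) {i j : ℕ} (hi : i < 2 * (m * k))
    (hj : j < 2 * (m * k)) (h : visit k i ≡ visit k j [MOD 2 * (m * k)]) : i = j := by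
  wlog hle : visit k i ≤ visit k j generalizing i j
  · exact (this hj hi h.symm (by omega)).symm
  obtain ⟨z, hz⟩ := (Nat.modEq_iff_dvd' hle).1 h
  have hz' : visit k j = visit k i + 2 * (z * m * k) := by
    have : 2 * (m * k) * z = 2 * (z * m * k) := by ring
    omega
  -- A surplus of `z` full turns in position is the same as a delay of `z` full periods in time.
  -- Strict monotonicity of `spread` then compares the times, and their range forces `z = 0`.
  rw [← visit_add_mul hk] at hz'
  have hpar : i % 2 = j % 2 := by
    have := congrArg (fun x => x / k % 2) hz'
    simp only [visit_div_mod_two hk] at this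
    omega
  have hij : j / 2 = i / 2 + z * m * k := by
    unfold visit at hz'
    rw [Nat.add_mul_mod_self_left, Nat.add_mul_div_left _ _ (by norm_num), hpar] at hz'
    split_ifs at hz'
    · have := (spread_strictMono k).injective hz'
      omega
    · exact (spread_strictMono k).injective (Nat.add_left_cancel hz')
  rcases Nat.eq_zero_or_pos z with rfl | hzpos
  · omega
  · have : 1 * (m * k) ≤ z * (m * k) := Nat.mul_le_mul_right _ hzpos
    rw [Nat.mul_assoc] at hij
    omega

/-- The optimal tour for a chunk boundary just before the point `o`. -/
noncomputable def optTour {m k : ℕ} (hk : 0 < k) (o : ℕ) : Equiv.Perm (Fin (2 * (m * k))) :=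
  Equiv.ofBijective
    (fun j => (⟨(o + visit k j) % (2 * (m * k)), Nat.mod_lt _ j.pos⟩ : Fin (2 * (m * k))))
    (Finite.injective_iff_bijective.1 fun i j h =>
      Fin.ext (visit_injOn_mod hk i.2 j.2 (Nat.ModEq.add_left_cancel' o (Fin.mk.inj h))))

theorem val_optTour {m k : ℕ} (hk : 0 < k) (o : ℕ) (j : Fin (2 * (m * k))) :
    ((optTour hk o j : Fin _) : ℕ) = (o + visit k j) % (2 * (m * k)) := rfl

theorem val_optTour_finRotate {m k : ℕ} (hk : 0 < k) (o : ℕ) (j : Fin (2 * (m * k))) :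
    ((optTour hk o (finRotate _ j) : Fin _) : ℕ) = (o + visit k (j + 1)) % (2 * (m * k)) := by
  rw [val_optTour, val_finRotate]
  rcases Nat.lt_or_ge ((j : ℕ) + 1) (2 * (m * k)) with h | h
  · rw [Nat.mod_eq_of_lt h]
  · have e : (j : ℕ) + 1 = 0 + 2 * (m * k) := by have := j.2; omega
    rw [e, visit_add_mul hk, Nat.add_mod_right, Nat.zero_mod, ← Nat.add_assoc, Nat.add_mod_right]

/-- Counted from the point `k - s % k`, where a chunk starts, positions have their colour determined
by the parity of `x / k`, up to a global swap. The offset is `k`, not 0, when the enumeration itself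
starts at a boundary. -/
theorem red_add_mod {m k s : ℕ} (hk : 0 < k) {red : Fin (2 * (m * k)) → Bool}
    (hred : ∀ i : Fin (2 * (m * k)), red i = decide (((i : ℕ) + s) / k % 2 = 0))
    (x : ℕ) {i : Fin (2 * (m * k))} (hi : (i : ℕ) = (k - s % k + x) % (2 * (m * k))) :
    red i = decide ((x / k + s / k + 1) % 2 = 0) := by
  have h1 := Nat.mod_add_div (k - s % k + x) (2 * (m * k))
  set z := (k - s % k + x) / (2 * (m * k))
  rw [← hi] at h1
  have h2 := Nat.mod_add_div s k
  have h3 := Nat.mod_lt s hk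
  have h4 : (i : ℕ) + s + k * (2 * (m * z)) = x + k * (s / k + 1) := by
    have : 2 * (m * k) * z = k * (2 * (m * z)) := by ring
    have : k * (s / k + 1) = k * (s / k) + k := by ring
    omega
  have h5 := congrArg (· / k) h4
  simp only [Nat.add_mul_div_left _ _ hk] at h5
  rw [hred]
  congr 2
  omega

theorem isTour_optTour {m k s : ℕ} (hk : 0 < k) {red : Fin (2 * (m * k)) → Bool}
    (hred : ∀ i : Fin (2 * (m * k)), red i = decide (((i : ℕ) + s) / k % 2 = 0)) :
    IsTour red (optTour (m := m) hk (k - s % k)) := by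
  intro j
  rw [red_add_mod hk hred _ (val_optTour hk _ j), red_add_mod hk hred _ (val_optTour_finRotate hk _ j)]
  have h1 := visit_div_mod_two hk j
  have h2 := visit_div_mod_two hk (j + 1)
  intro h
  rw [decide_eq_decide] at h
  omega

/-- Only an upper bound is needed for the constructed tour, so there is no need to know which arc is
the shorter one. -/
theorem val_sub_le {N X D : ℕ} {a b : Fin N} (ha : (a : ℕ) = X % N) (hb : (b : ℕ) = (X + D) % N) :
    ((b - a : Fin N) : ℕ) ≤ D := by
  have hN := a.pos
  rw [Fin.sub_def]
  change (N - a + b) % N ≤ D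
  rw [hb, Nat.add_mod_mod, ha]
  have h1 := Nat.mod_add_div X N
  have h2 := Nat.mod_lt X hN
  rw [show N - X % N + (X + D) = D + N * (X / N + 1) by rw [Nat.mul_add]; omega,
    Nat.add_mul_mod_self_left]
  exact Nat.mod_le _ _

theorem sum_range_two_mul (f : ℕ → ℕ) (n : ℕ) :
    ∑ j ∈ Finset.range (2 * n), f j = ∑ t ∈ Finset.range n, (f (2 * t) + f (2 * t + 1)) := by
  induction n with
  | zero => rfl
  | succ n ih =>
    rw [Finset.sum_range_succ, ← ih, Nat.mul_succ, Finset.sum_range_succ, Finset.sum_range_succ,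
      Nat.add_assoc]

theorem sum_range_add_ite (a b x y : ℕ) :
    ∑ p ∈ Finset.range (a + b), (if p < a then x else y) = a * x + b * y := by
  rw [Finset.sum_range_add, Finset.sum_congr rfl fun p hp => if_pos (Finset.mem_range.1 hp),
    Finset.sum_congr rfl fun p _ => if_neg (Nat.not_lt.2 (Nat.le_add_right a p))]
  simp

theorem sum_visit_dist {m k : ℕ} (hk : 0 < k) :
    ∑ j ∈ Finset.range (2 * (m * k)),
      ((visit k (j + 1) - visit k j) + (visit k j - visit k (j + 1))) =
    m * (k * k + if Even k then 2 else 1) := by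
  have hper : ∀ x, visit k (x + 2 * k) = visit k x + 2 * k := fun x => by
    simpa using visit_add_mul hk x 1
  set G : ℕ → ℕ := fun t => (visit k (2 * t + 1) - visit k (2 * t)) +
    (visit k (2 * t) - visit k (2 * t + 1)) + ((visit k (2 * t + 1 + 1) - visit k (2 * t + 1)) +
    (visit k (2 * t + 1) - visit k (2 * t + 1 + 1))) with hG
  have hGper : ∀ t, G (t + k) = G t := by
    intro t
    simp only [hG]
    rw [Nat.mul_add, Nat.add_right_comm _ (2 * k) 1, Nat.add_right_comm _ (2 * k) 1, hper, hper,
      hper]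
    omega
  -- The pointer of the shifted colour is behind the other one until it reaches the end of its
  -- chunk; then it jumps over a chunk and is ahead. The thresholds in `p` are these jumps, before
  -- and after its advance.
  have hGval : ∀ p ∈ Finset.range k, G p = (if p < k - k / 2 then k - k / 2 else k / 2) +
      (if p < k - k / 2 - 1 then k - k / 2 - 1 else k / 2 + 1) := by
    intro p hp
    rw [Finset.mem_range] at hp
    have hs : ∀ u, spread k u = if u < k then u else if u < 2 * k then u + k else spread k u := by
      intro u
      unfold spread
      split_ifs with h1 h2
      · rw [Nat.div_eq_of_lt h1]; rfl
      · rw [Nat.div_eq_of_lt_le (k := 1) (by omega) (by omega), Nat.mul_one]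
      · rfl
    have v0 : visit k (2 * p) = spread k (p + k / 2) := by
      unfold visit
      rw [if_pos (by omega)]
      congr 2
      omega
    have v1 : visit k (2 * p + 1) = k + spread k p := by
      unfold visit
      rw [if_neg (by omega)]
      congr 2
      omega
    have v2 : visit k (2 * p + 1 + 1) = spread k (p + 1 + k / 2) := by
      unfold visit
      rw [if_pos (by omega)]
      congr 2
      omega
    simp only [hG]
    rw [v0, v1, v2, hs (p + k / 2), hs p, hs (p + 1 + k / 2)]
    split_ifs <;> omega
  rw [sum_range_two_mul]
  have := sum_range_mul_of_periodic hGper m 0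
  rw [Finset.sum_congr rfl hGval] at this
  refine this.trans ?_
  congr 1
  have e1 := sum_range_add_ite (k - k / 2) (k / 2) (k - k / 2) (k / 2)
  have e2 := sum_range_add_ite (k - k / 2 - 1) (k / 2 + 1) (k - k / 2 - 1) (k / 2 + 1)
  rw [show k - k / 2 + k / 2 = k by omega] at e1
  rw [show k - k / 2 - 1 + (k / 2 + 1) = k by omega] at e2
  rw [Finset.sum_add_distrib, e1, e2]
  rcases Nat.even_or_odd' k with ⟨q, rfl | rfl⟩
  · obtain ⟨r, rfl⟩ : ∃ r, q = r + 1 := ⟨q - 1, by omega⟩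
    rw [if_pos (even_two_mul _), show 2 * (r + 1) / 2 = r + 1 by omega,
      show 2 * (r + 1) - (r + 1) = r + 1 by omega, Nat.add_sub_cancel]
    ring
  · rw [if_neg (Nat.not_even_iff_odd.2 (odd_two_mul_add_one q)), show (2 * q + 1) / 2 = q by omega,
      show 2 * q + 1 - q = q + 1 by omega, Nat.add_sub_cancel]
    ring

theorem tourLength_optTour_le {m k : ℕ} (hk : 0 < k) (o : ℕ) {c : ℂ} {P : Fin (2 * (m * k)) → ℂ}
    (hP : IsEquidistant c P) :
    tourLength c P (optTour (m := m) hk o) ≤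
      m * (k * k + if Even k then 2 else 1) + 2 * (m * k) := by
  have hedge : ∀ j : Fin (2 * (m * k)),
      edgeLength c P (P (optTour hk o j)) (P (optTour hk o (finRotate _ j))) ≤
      (visit k (j + 1) - visit k j) + (visit k j - visit k (j + 1)) + 1 := by
    intro j
    rw [edgeLength_eq hP]
    refine Nat.add_le_add_right ?_ 1
    rcases Nat.le_total (visit k j) (visit k (j + 1)) with h | h
    · refine (min_le_left _ _).trans (val_sub_le (val_optTour hk o j) ?_)
      rw [val_optTour_finRotate]
      congr 1
      omega
    · refine (min_le_right _ _).trans (val_sub_le (val_optTour_finRotate hk o j) ?_)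
      rw [val_optTour]
      congr 1
      omega
  refine (Finset.sum_le_sum fun j _ => hedge j).trans ?_
  rw [Fin.sum_univ_eq_sum_range
    (fun j => (visit k (j + 1) - visit k j) + (visit k j - visit k (j + 1)) + 1),
    Finset.sum_add_distrib, sum_visit_dist hk]
  simp

/-! ### A calculus for running times. -/

/-- Started in `S`, the program `p` halts within `T` steps in a state that satisfies `Q`. -/
def Runs (W T : ℕ) (p : Prog) (S : State) (Q : State → Prop) : Prop :=
  ∃ t ≤ T, ∃ S', Exec W p S t S' ∧ Q S'

namespace Runs

variable {W T B : ℕ} {p q : Prog} {S : State} {Q R : State → Prop}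

theorem mono (h : Runs W T p S Q) (hT : T ≤ B) (hQ : ∀ S', Q S' → R S') : Runs W B p S R := by
  obtain ⟨t, ht, S', he, hS'⟩ := h
  exact ⟨t, ht.trans hT, S', he, hQ _ hS'⟩

theorem const {x a : ℕ} (hW : a ≤ W) (h : Q ⟨Function.update S.reg x a, S.mem⟩) :
    Runs W (B + 1) (.const x a) S Q :=
  ⟨1, Nat.le_add_left _ _, _, .const _ _ _ hW, h⟩

theorem add {x y z : ℕ} (hW : S.reg y + S.reg z ≤ W)
    (h : Q ⟨Function.update S.reg x (S.reg y + S.reg z), S.mem⟩) :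
    Runs W (B + 1) (.add x y z) S Q :=
  ⟨1, Nat.le_add_left _ _, _, .add _ _ _ _ hW, h⟩

theorem sub {x y z : ℕ} (hW : S.reg y ≤ W)
    (h : Q ⟨Function.update S.reg x (S.reg y - S.reg z), S.mem⟩) :
    Runs W (B + 1) (.sub x y z) S Q :=
  ⟨1, Nat.le_add_left _ _, _, .sub _ _ _ _ ((Nat.sub_le _ _).trans hW), h⟩

theorem load {x y : ℕ} (h : Q ⟨Function.update S.reg x (S.mem (S.reg y)), S.mem⟩) :
    Runs W (B + 1) (.load x y) S Q :=
  ⟨1, Nat.le_add_left _ _, _, .load _ _ _, h⟩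

theorem store {x y : ℕ} (h : Q ⟨S.reg, Function.update S.mem (S.reg x) (S.reg y)⟩) :
    Runs W (B + 1) (.store x y) S Q :=
  ⟨1, Nat.le_add_left _ _, _, .store _ _ _, h⟩

theorem skip (h : Q S) : Runs W (B + 1) .skip S Q :=
  ⟨1, Nat.le_add_left _ _, _, .skip _, h⟩

/-- The rest of the program is part of the postcondition, so a proof follows the execution in the
style of weakest preconditions. -/
theorem seq (h : Runs W T p S fun S' => Runs W B q S' Q) : Runs W (B + T) (.seq p q) S Q := by
  obtain ⟨t, ht, S', he, t', ht', S'', he', hQ⟩ := h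
  exact ⟨t + t', by omega, S'', .seq _ _ _ _ _ _ _ he he', hQ⟩

theorem seq_one (h : Runs W 1 p S fun S' => Runs W B q S' Q) : Runs W (B + 1) (.seq p q) S Q :=
  h.seq

theorem ite {x y : ℕ} (h₁ : S.reg x < S.reg y → Runs W B p S Q)
    (h₂ : ¬ S.reg x < S.reg y → Runs W B q S Q) : Runs W (B + 1) (.ite x y p q) S Q := by
  by_cases h : S.reg x < S.reg y
  · obtain ⟨t, ht, S', he, hQ⟩ := h₁ h
    exact ⟨t + 1, by omega, S', .ite_true _ _ _ _ _ _ _ h he, hQ⟩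
  · obtain ⟨t, ht, S', he, hQ⟩ := h₂ h
    exact ⟨t + 1, by omega, S', .ite_false _ _ _ _ _ _ _ h he, hQ⟩

theorem loop {x y L : ℕ} (I : ℕ → State → Prop) (h₀ : I 0 S)
    (hstep : ∀ i < L, ∀ S, I i S → S.reg x < S.reg y ∧ Runs W T p S (I (i + 1)))
    (hend : ∀ S, I L S → ¬ S.reg x < S.reg y ∧ Q S) :
    Runs W (L * (T + 1) + 1) (.loop x y p) S Q := by
  induction L generalizing S I with
  | zero => exact ⟨1, Nat.le_add_left _ _, S, .loop_false _ _ _ _ (hend S h₀).1, (hend S h₀).2⟩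
  | succ L ih =>
    obtain ⟨hlt, t, ht, S', he, hS'⟩ := hstep 0 (Nat.succ_pos _) S h₀
    obtain ⟨t', ht', S'', he', hQ⟩ := ih (fun i => I (i + 1)) hS'
      (fun i hi => hstep (i + 1) (Nat.succ_lt_succ hi)) hend
    refine ⟨t + t' + 1, ?_, S'', .loop_true _ _ _ _ _ _ _ _ hlt he he', hQ⟩
    rw [Nat.succ_mul]
    omega

end Runs

/-! ### The program and its correctness. -/

/-- Moves register `2` to the next memory cell whose content differs from the current one. -/
def scanProg : Prog :=
  .seq (.load 3 2) <| .seq (.const 7 0) <| .loop 7 1 <|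
    .seq (.add 2 2 1) <| .seq (.load 4 2) <| .seq (.sub 5 4 3) <| .seq (.sub 6 3 4) <| .add 7 5 6

/-- The two truncated differences add up to the absolute difference, so register `7` stays below `1`
exactly while the content is unchanged. -/
theorem runs_scanProg {W L : ℕ} {S : State} (h1 : S.reg 1 = 1) (hL : 0 < L)
    (heq : ∀ j < L, S.mem (S.reg 2 + j) = S.mem (S.reg 2))
    (hne : S.mem (S.reg 2 + L) ≠ S.mem (S.reg 2)) (hmem : ∀ a, S.mem a ≤ W)
    (hW : S.reg 2 + L ≤ W) :
    Runs W (L * 6 + 3) scanProg S fun S' =>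
      S'.reg 2 = S.reg 2 + L ∧ (∀ r, r < 2 ∨ 7 < r → S'.reg r = S.reg r) ∧ S'.mem = S.mem := by
  refine .seq_one (.load <| .seq_one (.const (Nat.zero_le _) ?_))
  refine Runs.loop (T := 5) (fun j S' => S'.reg 2 = S.reg 2 + j ∧ S'.reg 3 = S.mem (S.reg 2) ∧
    (S'.reg 7 = 0 ↔ j < L) ∧ (∀ r, r < 2 ∨ 7 < r → S'.reg r = S.reg r) ∧ S'.mem = S.mem) ?_ ?_ ?_
  · refine ⟨by simp, by simp, by simp [hL], fun r hr => ?_, rfl⟩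
    have : r ≠ 3 ∧ r ≠ 7 := by omega
    simp [this]
  · rintro j hj S' ⟨h2, h3, h7, hr, hm⟩
    refine ⟨by rw [h7.2 hj, hr 1 (by simp), h1]; exact one_pos, ?_⟩
    have e1 : S'.reg 1 = 1 := by rw [hr 1 (by simp), h1]
    have b1 := hmem (S.reg 2 + (j + 1))
    have b2 := hmem (S.reg 2)
    refine .seq_one (.add ?_ <| .seq_one <| .load <| .seq_one <| .sub ?_ <| .seq_one <| .sub ?_ <|
      .add ?_ ?_)
    · rw [h2, e1]; omega
    · simpa [h2, e1, hm, Nat.add_assoc] using b1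
    · simpa [h3] using b2
    · simp [h2, h3, e1, hm]
      rw [Nat.add_assoc]
      omega
    · refine ⟨?_, ?_, ?_, ?_, hm⟩
      · simp [h2, e1, Nat.add_assoc]
      · simp [h3]
      · have key : S.mem (S.reg 2 + (j + 1)) = S.mem (S.reg 2) ↔ j + 1 < L := by
          constructor
          · intro h
            rcases Nat.lt_or_ge (j + 1) L with h' | h'
            · exact h'
            · rw [show j + 1 = L by omega] at h
              exact absurd h hne
          · exact heq _
        rw [← key]
        simp [h2, h3, e1, hm, Nat.add_assoc]
        omega
      · intro r hr'
        have : r ≠ 2 ∧ r ≠ 4 ∧ r ≠ 5 ∧ r ≠ 6 ∧ r ≠ 7 := by omega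
        simp [this, hr r hr']
  · rintro S' ⟨h2, h3, h7, hr, hm⟩
    refine ⟨?_, h2, hr, hm⟩
    rw [hr 1 (by simp), h1]
    have : S'.reg 7 ≠ 0 := fun h => Nat.lt_irrefl _ (h7.1 h)
    omega

/-- Finds the first chunk boundary and the size of the chunk that starts there. -/
def chunkProg : Prog :=
  .seq (.const 1 1) <| .seq (.const 2 2) <| .seq (.store 0 2) <| .seq (.const 2 0) <|
  .seq scanProg <| .seq (.add 8 2 9) <| .seq scanProg <| .sub 10 2 8

theorem runs_chunkProg {m k s W : ℕ} (hm : 0 < m) (hk : 0 < k) {red : Fin (2 * (m * k)) → Bool}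
    (hred : ∀ i : Fin (2 * (m * k)), red i = decide (((i : ℕ) + s) / k % 2 = 0))
    (hW : 2 * (m * k) ≤ W) :
    Runs W (k * 12 + 12) chunkProg (inputState red) fun S =>
      S.reg 0 = 2 * (m * k) ∧ S.reg 1 = 1 ∧ S.reg 2 = k - s % k + k ∧ S.reg 8 = k - s % k ∧
      S.reg 10 = k ∧ ∀ r, r = 9 ∨ 10 < r → S.reg r = 0 := by
  have hkm : k ≤ m * k := Nat.le_mul_of_pos_left k hm
  have hs := Nat.mod_lt s hk
  have hdm := Nat.mod_add_div s k
  set o := k - s % k with ho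
  set M : ℕ → ℕ := Function.update (inputState red).mem (2 * (m * k)) 2 with hM
  have hMN : M (2 * (m * k)) = 2 := Function.update_self _ _ _
  have hMlt : ∀ a < 2 * (m * k), M a = if (a + s) / k % 2 = 0 then 1 else 0 := by
    intro a ha
    rw [hM, Function.update_of_ne ha.ne]
    simp [inputState, ha, hred]
  have hMW : ∀ a, M a ≤ W := by
    intro a
    rcases eq_or_ne a (2 * (m * k)) with rfl | h
    · omega
    · rw [hM, Function.update_of_ne h]
      simp only [inputState]
      split_ifs <;> omega
  have d0 : ∀ j < o, (j + s) / k = s / k := by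
    intro j hj
    refine Nat.div_eq_of_lt_le ?_ ?_ <;> rw [Nat.mul_comm]
    · omega
    · rw [Nat.mul_add]; omega
  have d1 : ∀ j < k, (o + j + s) / k = s / k + 1 := by
    intro j hj
    refine Nat.div_eq_of_lt_le ?_ ?_ <;> rw [Nat.mul_comm]
    · rw [Nat.mul_add]; omega
    · rw [Nat.mul_add, Nat.mul_add]; omega
  have d2 : (o + k + s) / k = s / k + 2 := by
    refine Nat.div_eq_of_lt_le ?_ ?_ <;> rw [Nat.mul_comm]
    · rw [Nat.mul_add]; omega
    · rw [Nat.mul_add, Nat.mul_add]; omega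
  have z0 : (0 + s) / k = s / k := by rw [Nat.zero_add]
  have scans : ∀ S : State, S.reg 0 = 2 * (m * k) → S.reg 1 = 1 → S.reg 2 = 0 →
      (∀ r, r = 9 ∨ 10 < r → S.reg r = 0) → S.mem = M →
      Runs W (k * 6 + 3 + 1 + (k * 6 + 3) + 1)
        (.seq scanProg <| .seq (.add 8 2 9) <| .seq scanProg <| .sub 10 2 8) S fun S =>
        S.reg 0 = 2 * (m * k) ∧ S.reg 1 = 1 ∧ S.reg 2 = o + k ∧ S.reg 8 = o ∧
        S.reg 10 = k ∧ ∀ r, r = 9 ∨ 10 < r → S.reg r = 0 := by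
    intro S h0 h1 h2 hr hmem
    refine Runs.mono (T := k * 6 + 3 + 1 + 1 + (o * 6 + 3)) (.seq ?_) (by omega) fun _ h => h
    refine (runs_scanProg (L := o) h1 (by omega) ?_ ?_ (by rwa [hmem]) (by omega)).mono le_rfl ?_
    · intro j hj
      rw [hmem, h2, Nat.zero_add, hMlt _ (by omega), hMlt 0 (by omega), d0 j hj, z0]
    · rw [hmem, h2, Nat.zero_add, hMlt _ (by omega), hMlt 0 (by omega), z0]
      have := d1 0 hk
      rw [Nat.add_zero] at this
      rw [this]
      split_ifs <;> omega
    rintro S₁ ⟨g2, gr, gm⟩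
    rw [h2, Nat.zero_add] at g2
    have g9 : S₁.reg 9 = 0 := by rw [gr 9 (by simp), hr 9 (by simp)]
    refine .seq_one (.add (by rw [g2, g9]; omega) ?_)
    rw [g9, g2]
    refine Runs.mono (T := 1 + (k * 6 + 3)) (.seq ?_) (by omega) fun _ h => h
    have e2 : (Function.update S₁.reg 8 (o + 0)) 2 = o := by simp [g2]
    refine (runs_scanProg (L := k) ?_ hk ?_ ?_ ?_ ?_).mono le_rfl ?_
    · simp [gr 1, h1]
    · intro j hj
      simp only [e2, gm, hmem]
      have := d1 0 hk
      rw [Nat.add_zero] at this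
      rw [hMlt _ (by omega), hMlt _ (by omega), d1 j hj, this]
    · simp only [e2, gm, hmem]
      have := d1 0 hk
      rw [Nat.add_zero] at this
      rw [hMlt o (by omega), this]
      -- If the chunk ends with the last point, the scan is stopped by the sentinel `2` stored
      -- behind the input, which differs from both colours.
      rcases (show o + k ≤ 2 * (m * k) by omega).lt_or_eq with h | h
      · rw [hMlt _ h, d2]
        split_ifs <;> omega
      · rw [h, hMN]
        split_ifs <;> omega
    · simp only [gm, hmem]
      exact hMW
    · simp only [e2]
      omega
    rintro S₂ ⟨f2, fr, fm⟩
    simp only [e2] at f2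
    have f8 : S₂.reg 8 = o := by rw [fr 8 (by simp)]; simp
    refine .sub (by rw [f2]; omega) ?_
    have f : ∀ r, r ≠ 8 → r < 2 ∨ 7 < r → S₂.reg r = S.reg r := by
      intro r h8 hr'
      rw [fr r hr']
      simp [h8, gr r hr']
    refine ⟨by simp [f, h0], by simp [f, h1], by simp [f2], by simp [f8], by simp [f2, f8], ?_⟩
    intro r hr'
    have h10 : r ≠ 10 ∧ r ≠ 8 := by omega
    simp only [ne_eq, h10.1, not_false_eq_true, Function.update_of_ne]
    rw [f r h10.2 (by omega), hr r hr']
  refine Runs.mono (T := k * 6 + 3 + 1 + (k * 6 + 3) + 1 + 1 + 1 + 1 + 1) ?_ (by omega) fun _ h => h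
  refine .seq_one <| .const (by omega) <| .seq_one <| .const (by omega) <|
    .seq_one <| .store <| .seq_one <| .const (Nat.zero_le _) ?_
  refine scans _ ?_ ?_ ?_ ?_ ?_
  · simp [inputState]
  · simp
  · simp
  · intro r hr
    have : r ≠ 1 ∧ r ≠ 2 ∧ r ≠ 0 := by omega
    simp [inputState, this]
  · simp [hM, inputState]

/-- Replaces register `p` by its remainder modulo register `0`. -/
def wrapProg (p : ℕ) : Prog := .ite p 0 .skip (.sub p p 0)

theorem runs_wrapProg {W p : ℕ} {S : State} (hlt : S.reg p < 2 * S.reg 0)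
    (hW : S.reg p ≤ W) :
    Runs W 2 (wrapProg p) S fun S' => S' = ⟨Function.update S.reg p (S.reg p % S.reg 0), S.mem⟩ := by
  refine .ite (fun h => .skip ?_) (fun h => .sub hW ?_)
  · rw [Nat.mod_eq_of_lt h, Function.update_eq_self]
  · rw [Nat.mod_eq_sub_mod (by omega), Nat.mod_eq_of_lt (by omega)]

/-- Moves register `p` to the next point of the same colour; register `c` holds the position
in the chunk, register `10` the chunk size. -/
def nextProg (p c : ℕ) : Prog :=
  .seq (.add p p 1) <| .seq (.add c c 1) <|
  .seq (.ite c 10 .skip (.seq (.const c 0) (.add p p 10))) <| wrapProg p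

theorem runs_nextProg {W k N p c : ℕ} {S : State} (hp : 10 < p) (hpc : p < c)
    (h0 : S.reg 0 = N) (h1 : S.reg 1 = 1) (hk : S.reg 10 = k) (hc : S.reg c < k)
    (hlt : S.reg p + 1 + k < 2 * N) (hW : 2 * N ≤ W) :
    Runs W 7 (nextProg p c) S fun S' =>
      S'.reg p = (if S.reg c + 1 < k then S.reg p + 1 else S.reg p + 1 + k) % N ∧
      S'.reg c = (if S.reg c + 1 < k then S.reg c + 1 else 0) ∧
      (∀ r, r ≠ p → r ≠ c → S'.reg r = S.reg r) ∧ S'.mem = S.mem := by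
  have n1 : 1 ≠ p := by omega
  have n2 : 1 ≠ c := by omega
  have n3 : 10 ≠ p := by omega
  have n4 : 10 ≠ c := by omega
  have n5 : p ≠ c := by omega
  have n6 : 0 ≠ p := by omega
  have n7 : 0 ≠ c := by omega
  refine .seq_one (.add (by rw [h1]; omega) <| .seq_one <| .add ?_ ?_)
  · simp [n1, n5.symm, h1]
    omega
  refine Runs.seq (T := 3) (B := 2) (.ite ?_ ?_)
  · intro h
    simp [n1, n3, n4, n5.symm, h1, hk] at h
    refine .skip ?_
    refine (runs_wrapProg ?_ ?_).mono le_rfl ?_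
    · simp [n1, n5, n6, n7, h1, h0]
      omega
    · simp [n1, n5, h1]
      omega
    · rintro _ rfl
      refine ⟨?_, ?_, ?_, rfl⟩
      · simp [n1, n5, n6, n7, h1, h0, h]
      · simp [n1, n5.symm, h1, h]
      · intro r hr hr'
        simp [hr, hr']
  · intro h
    simp [n1, n3, n4, n5.symm, h1, hk] at h
    refine .seq_one (.const (Nat.zero_le _) (.add ?_ ?_))
    · simp [n1, n3, n4, n5, h1, hk]
      omega
    refine (runs_wrapProg ?_ ?_).mono le_rfl ?_
    · simp [n1, n3, n4, n5, n6, n7, h1, h0, hk]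
      omega
    · simp [n1, n3, n4, n5, h1, hk]
      omega
    · rintro _ rfl
      refine ⟨?_, ?_, ?_, rfl⟩
      · simp [n1, n3, n4, n5, n6, n7, h1, h0, hk, Nat.not_lt.2 h]
      · simp [n5.symm, Nat.not_lt.2 h]
      · intro r hr hr'
        simp [hr, hr']

/-- Stores half of register `10` in register `11`. -/
def halfProg : Prog :=
  .seq (.const 12 1) <| .loop 12 10 <|
    .seq (.add 11 11 1) <| .seq (.add 12 12 1) <| .add 12 12 1

theorem runs_halfProg {W k : ℕ} {S : State} (h1 : S.reg 1 = 1) (hk : S.reg 10 = k)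
    (h11 : S.reg 11 = 0) (hW : k < W) :
    Runs W (k / 2 * 4 + 2) halfProg S fun S' =>
      S'.reg 11 = k / 2 ∧ ∀ r, r ≠ 11 → r ≠ 12 → S'.reg r = S.reg r := by
  refine .seq_one (.const (by omega) ?_)
  -- Starting the counter at 1 makes the number of rounds with `2 * j + 1 < k` equal to `k / 2` for
  -- both parities.
  refine Runs.loop (T := 3) (fun j S' => S'.reg 11 = j ∧ S'.reg 12 = 2 * j + 1 ∧
    ∀ r, r ≠ 11 → r ≠ 12 → S'.reg r = S.reg r) ?_ ?_ ?_
  · refine ⟨by simp [h11], by simp, fun r _ hr => by simp [hr]⟩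
  · rintro j hj S' ⟨g11, g12, gr⟩
    have g1 : S'.reg 1 = 1 := by rw [gr 1 (by simp) (by simp), h1]
    have g10 : S'.reg 10 = k := by rw [gr 10 (by simp) (by simp), hk]
    refine ⟨by rw [g12, g10]; omega, ?_⟩
    refine .seq_one <| .add (by rw [g11, g1]; omega) <| .seq_one <| .add ?_ <| .add ?_ ?_
    · simp [g12, g1]; omega
    · simp [g12, g1]; omega
    · refine ⟨by simp [g11, g1], by simp [g12, g1]; ring, fun r hr hr' => ?_⟩
      simp [hr, hr', gr]
  · rintro S' ⟨g11, g12, gr⟩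
    refine ⟨by rw [g12, gr 10 (by simp) (by simp), hk]; omega, g11, gr⟩

theorem succ_mod_eq {k : ℕ} (hk : 0 < k) (u : ℕ) :
    (u + 1) % k = if u % k + 1 < k then u % k + 1 else 0 := by
  have h := Nat.mod_lt u hk
  rw [← Nat.mod_add_mod]
  split_ifs with hc
  · exact Nat.mod_eq_of_lt hc
  · rw [show u % k + 1 = k by omega, Nat.mod_self]

/-- This recursion is what `nextProg` carries out: one step within a chunk, a jump over the foreign
chunk at its end. -/
theorem spread_succ {k : ℕ} (hk : 0 < k) (u : ℕ) :
    spread k (u + 1) = if u % k + 1 < k then spread k u + 1 else spread k u + 1 + k := by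
  have h1 := Nat.mod_add_div u k
  have h2 := Nat.mod_add_div (u + 1) k
  have h3 := succ_mod_eq hk u
  have h4 := Nat.mod_lt u hk
  unfold spread
  by_cases hc : u % k + 1 < k
  · rw [if_pos hc] at h3 ⊢
    rw [h3] at h2
    omega
  · rw [if_neg hc] at h3 ⊢
    rw [h3] at h2
    omega

/-- Writes the tour, with registers `13` and `15` as pointers to the next points. -/
def emitProg : Prog :=
  .loop 17 18 <| .seq (.store 17 13) <| .seq (.add 17 17 1) <| .seq (.store 17 15) <|
    .seq (.add 17 17 1) <| .seq (nextProg 13 14) <| nextProg 15 16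

theorem runs_emitProg {W m k o : ℕ} {S : State} (hm : 0 < m) (hk : 0 < k)
    (hW : 4 * (m * k) + 4 * (m * k) ≤ W)
    (h0 : S.reg 0 = 2 * (m * k)) (h1 : S.reg 1 = 1) (h10 : S.reg 10 = k)
    (h13 : S.reg 13 = (o + spread k (k / 2)) % (2 * (m * k))) (h14 : S.reg 14 = k / 2)
    (h15 : S.reg 15 = (o + (k + spread k 0)) % (2 * (m * k))) (h16 : S.reg 16 = 0)
    (h17 : S.reg 17 = 2 * (m * k)) (h18 : S.reg 18 = 4 * (m * k)) :
    Runs W (m * k * 19 + 1) emitProg S fun S' =>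
      ∀ j < 2 * (m * k), S'.mem (2 * (m * k) + j) = (o + visit k j) % (2 * (m * k)) := by
  have hkm : k ≤ m * k := Nat.le_mul_of_pos_left k hm
  set N := 2 * (m * k) with hN
  have hNpos : 0 < N := by omega
  refine Runs.loop (T := 18) (fun t S' => (S'.reg 0 = N ∧ S'.reg 1 = 1 ∧ S'.reg 10 = k ∧
    S'.reg 17 = N + 2 * t ∧ S'.reg 18 = 4 * (m * k)) ∧
    S'.reg 13 = (o + spread k (t + k / 2)) % N ∧ S'.reg 14 = (t + k / 2) % k ∧
    S'.reg 15 = (o + (k + spread k t)) % N ∧ S'.reg 16 = t % k ∧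
    ∀ j < 2 * t, S'.mem (N + j) = (o + visit k j) % N) ?_ ?_ ?_
  · refine ⟨⟨h0, h1, h10, h17, h18⟩, ?_, ?_, h15, ?_, ?_⟩
    · rw [h13, Nat.zero_add]
    · rw [h14, Nat.zero_add, Nat.mod_eq_of_lt (by omega)]
    · rw [h16, Nat.zero_mod]
    · intro j hj
      omega
  · rintro t ht S' ⟨⟨g0, g1, g10, g17, g18⟩, g13, g14, g15, g16, gm⟩
    refine ⟨by rw [g17, g18]; omega, ?_⟩
    have b13 : S'.reg 13 < N := by rw [g13]; exact Nat.mod_lt _ hNpos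
    have b15 : S'.reg 15 < N := by rw [g15]; exact Nat.mod_lt _ hNpos
    refine Runs.seq_one (B := 17) (.store <| .seq_one <| .add ?_ <| .seq_one <| .store <|
      .seq_one <| .add ?_ <| Runs.seq (B := 7) (T := 7) ?_)
    · simp only [g17, g1]; omega
    · simp [g17, g1]; omega
    refine (runs_nextProg (k := k) (N := N) (by simp) (by simp) ?_ ?_ ?_ ?_ ?_ (by omega)).mono
      le_rfl ?_
    · simp [g0]
    · simp [g1]
    · simp [g10]
    · simpa [g14] using Nat.mod_lt _ hk
    · simp
      omega
    rintro S₁ ⟨e13, e14, er, em⟩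
    refine (runs_nextProg (k := k) (N := N) (by simp) (by simp) ?_ ?_ ?_ ?_ ?_ (by omega)).mono
      le_rfl ?_
    · rw [er _ (by simp) (by simp)]; simp [g0]
    · rw [er _ (by simp) (by simp)]; simp [g1]
    · rw [er _ (by simp) (by simp)]; simp [g10]
    · rw [er _ (by simp) (by simp)]; simpa [g16] using Nat.mod_lt _ hk
    · rw [er _ (by simp) (by simp)]; simp; omega
    rintro S₂ ⟨e15, e16, er', em'⟩
    rw [er 15 (by simp) (by simp), er 16 (by simp) (by simp)] at e15
    rw [er 16 (by simp) (by simp)] at e16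
    have f : ∀ r, r ≠ 13 → r ≠ 14 → r ≠ 15 → r ≠ 16 → r ≠ 17 → S₂.reg r = S'.reg r := by
      intro r a1 a2 a3 a4 a5
      rw [er' r a3 a4, er r a1 a2]
      simp [a5]
    refine ⟨⟨?_, ?_, ?_, ?_, ?_⟩, ?_, ?_, ?_, ?_, ?_⟩
    · simp [f, g0]
    · simp [f, g1]
    · simp [f, g10]
    · rw [er' 17 (by simp) (by simp), er 17 (by simp) (by simp)]
      simp [g17, g1]
      omega
    · simp [f, g18]
    · rw [er' 13 (by simp) (by simp), e13, Nat.add_right_comm t 1, spread_succ hk]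
      simp [g13, g14]
      split_ifs <;> simp [Nat.add_assoc]
    · rw [er' 14 (by simp) (by simp), e14, Nat.add_right_comm t 1, succ_mod_eq hk]
      simp [g14]
    · rw [e15, spread_succ hk]
      simp [g15, g16]
      split_ifs <;> simp [Nat.add_assoc]
    · rw [e16, succ_mod_eq hk]
      simp [g16]
    · intro j hj
      rw [em', em]
      simp only [g17, g1]
      rcases Nat.lt_or_ge j (2 * t) with h | h
      · rw [← gm j h]
        have n1 : j ≠ 2 * t := by omega
        have n2 : j ≠ 2 * t + 1 := by omega
        simp [Nat.add_assoc, n1, n2]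
      · rcases (show j = 2 * t ∨ j = 2 * t + 1 by omega) with rfl | rfl
        · have v : visit k (2 * t) = spread k (t + k / 2) := by
            unfold visit
            rw [if_pos (by omega)]
            congr 2
            omega
          rw [v, ← g13]
          simp
        · have v : visit k (2 * t + 1) = k + spread k t := by
            unfold visit
            rw [if_neg (by omega)]
            congr 2
            omega
          rw [v, ← g15]
          simp [Nat.add_assoc]
  · rintro S' ⟨⟨g0, g1, g10, g17, g18⟩, -, -, -, -, gm⟩
    exact ⟨by rw [g17, g18]; omega, gm⟩

/-- The whole program. -/
def tourProg : Prog :=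
  .seq chunkProg <| .seq halfProg <| .seq (.add 13 8 11) <| .seq (.add 14 11 9) <|
  .seq (.add 15 2 9) <| .seq (wrapProg 15) <| .seq (.add 17 0 9) <| .seq (.add 18 0 0) emitProg

theorem runs_tourProg {m k s W : ℕ} (hm : 0 < m) (hk : 0 < k) {red : Fin (2 * (m * k)) → Bool}
    (hred : ∀ i : Fin (2 * (m * k)), red i = decide (((i : ℕ) + s) / k % 2 = 0))
    (hW : 4 * (m * k) + 4 * (m * k) ≤ W) :
    Runs W (100 * (m * k)) tourProg (inputState red) fun S =>
      ∀ j < 2 * (m * k), S.mem (2 * (m * k) + j) = (k - s % k + visit k j) % (2 * (m * k)) := by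
  have hkm : k ≤ m * k := Nat.le_mul_of_pos_left k hm
  have hs := Nat.mod_lt s hk
  refine Runs.mono (T := m * k * 19 + 1 + 1 + 1 + 2 + 1 + 1 + 1 + (k / 2 * 4 + 2) + (k * 12 + 12))
    (.seq ?_) (by omega) fun _ h => h
  refine (runs_chunkProg hm hk hred (by omega)).mono le_rfl ?_
  rintro S ⟨h0, h1, h2, h8, h10, hr⟩
  refine .seq ((runs_halfProg h1 h10 (hr 11 (by simp)) (by omega)).mono le_rfl ?_)
  rintro S₁ ⟨g11, gr⟩
  have g0 : S₁.reg 0 = 2 * (m * k) := by rw [gr _ (by simp) (by simp), h0]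
  have g1 : S₁.reg 1 = 1 := by rw [gr _ (by simp) (by simp), h1]
  have g2 : S₁.reg 2 = k - s % k + k := by rw [gr _ (by simp) (by simp), h2]
  have g8 : S₁.reg 8 = k - s % k := by rw [gr _ (by simp) (by simp), h8]
  have g9 : S₁.reg 9 = 0 := by rw [gr _ (by simp) (by simp), hr 9 (by simp)]
  have g10 : S₁.reg 10 = k := by rw [gr _ (by simp) (by simp), h10]
  have g16 : S₁.reg 16 = 0 := by rw [gr _ (by simp) (by simp), hr 16 (by simp)]
  refine .seq_one <| .add ?_ <| .seq_one <| .add ?_ <| .seq_one <| .add ?_ <| .seq (T := 2) ?_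
  · rw [g8, g11]; omega
  · simp [g11, g9]; omega
  · simp [g2, g9]; omega
  -- The start of the second colour, `k - s % k + k`, can equal the number of points and has to be
  -- wrapped; that of the first colour is always smaller.
  refine (runs_wrapProg ?_ ?_).mono le_rfl ?_
  · simp [g2, g9, g0]; omega
  · simp [g2, g9]; omega
  rintro _ rfl
  refine .seq_one <| .add ?_ <| .seq_one <| .add ?_ ?_
  · simp [g0, g9]; omega
  · simp [g0]; omega
  refine runs_emitProg hm hk hW ?_ ?_ ?_ ?_ ?_ ?_ ?_ ?_ ?_
  · simp [g0]
  · simp [g1]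
  · simp [g10]
  · have : spread k (k / 2) = k / 2 := by
      unfold spread
      rw [Nat.div_eq_of_lt (by omega : k / 2 < k)]
      simp
    rw [this, Nat.mod_eq_of_lt (by omega : k - s % k + k / 2 < 2 * (m * k))]
    simp [g8, g11]
  · simp [g11, g9]
  · simp [g2, g9, g0, spread]
  · simp [g16]
  · simp [g0, g9]
  · simp [g0]; omega

end ChunkedTour

theorem mainTheorem6 :
    -- one program and one constant for all instances
    ∃ (prog : ChunkedTour.Prog) (C : ℕ),
      ∀ (n k : ℕ) (_ : 0 < n) (c : ℂ) (P : Fin (2 * n) → ℂ) (red : Fin (2 * n) → Bool)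
        (_ : ChunkedTour.IsEquidistant c P) (_ : ChunkedTour.IsChunked n k red),
        ∃ (t : ℕ) (S : ChunkedTour.State) (τ : Equiv.Perm (Fin (2 * n))),
          -- the program halts within `C * n` steps, on machine words of `O(log n)` bits,
          ChunkedTour.Exec (C * n) prog (ChunkedTour.inputState red) t S ∧
          t ≤ C * n ∧
          -- and outputs a tour of minimum length,
          ChunkedTour.Outputs S τ ∧
          ChunkedTour.IsOptimalTour c P red τ ∧
          -- which has the following length
          (Even k → (ChunkedTour.tourLength c P τ : ℝ) = n * ((k : ℝ) + 2 + 2 / k)) ∧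
          (Odd k → (ChunkedTour.tourLength c P τ : ℝ) = n * ((k : ℝ) + 2 + 1 / k)) := by
  -- The parts of the program take at most `33 * n + 22` steps together.
  refine ⟨ChunkedTour.tourProg, 100, ?_⟩
  rintro n k hn c P red hP ⟨hk, hdvd, s, hred⟩
  obtain ⟨m, rfl⟩ := exists_eq_mul_left_of_dvd hdvd
  have hm : 0 < m := Nat.pos_of_mul_pos_right hn
  have hkR : (k : ℝ) ≠ 0 := by exact_mod_cast hk.ne'
  obtain ⟨t, ht, S, hexec, hout⟩ :=
    ChunkedTour.runs_tourProg (W := 100 * (m * k)) hm hk hred (by omega)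
  have htour := ChunkedTour.isTour_optTour (m := m) hk hred
  have hle := ChunkedTour.tourLength_optTour_le (m := m) hk (k - s % k) hP
  have hlen := le_antisymm hle (ChunkedTour.le_tourLength hm hk hP hred htour)
  refine ⟨t, S, ChunkedTour.optTour hk (k - s % k), hexec, ht, fun j => hout j j.2,
    ⟨htour, fun τ' hτ' => hle.trans (ChunkedTour.le_tourLength hm hk hP hred hτ')⟩, ?_, ?_⟩
  · intro hev
    rw [hlen, if_pos hev]
    push_cast
    field_simp
    ring
  · intro hodd
    rw [hlen, if_neg (Nat.not_even_iff_odd.2 hodd)]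
    push_cast
    field_simp
    ring
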